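/- Let $\mathfrak O$ be a compact discrete valuation ring with maximal ideal $\mathfrak P$, and let $q=|\mathfrak O/\mathfrak P|$. For a module $M\subseteq \mathrm{Mat}_{d\times e}(\mathfrak O)$, let $M_k$ be its image in $\mathrm{Mat}_{d\times e}(\mathfrak O/\mathfrak P^k)$ and define the ask zeta function $$\mathsf Z^{\mathrm{ask}}_M(Y)=\sum_{k\ge 0}\Bigl(\frac1{|M_k|}\sum_{A\in M_k}\bigl|\{x\in(\mathfrak O/\mathfrak P^k)^d : xA=0\}\bigr|\Bigr)Y^k\in\mathbb Q[[Y]].$$ Let $\mathrm{Mat}_{d_1\times e_1}(\mathfrak O)\oplus\dotsb\oplus\mathrm{Mat}_{d_n\times e_n}(\mathfrak O)$ denote the module of all block diagonal matrices with $i$th diagonal block in $\mathrm{Mat}_{d_i\times e_i}(\mathfrak O)$. Order the coloured positive integers $\sigma^c$ ($\sigma\ge 1$, $c\ge 0$) by $\sigma^c<\tau^{c'}$ if and only if $c>c'$, or $c=c'$ and $\sigma<\tau$. For a coloured permutation $\boldsymbol a=\sigma_1^{\gamma_1}\dotsb\sigma_n^{\gamma_n}$ (with distinct $\sigma_i$),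 let $\mathrm{Des}(\boldsymbol a)$ consist of all $i\in\{1,\dotsc,n-1\}$ with $\sigma_i^{\gamma_i}>\sigma_{i+1}^{\gamma_{i+1}}$, together with $0$ if $n\ge 1$ and $\gamma_1\ne 0$. Put $\mathrm{des}(\boldsymbol a)=|\mathrm{Des}(\boldsymbol a)|$ and $\mathrm{comaj}(\boldsymbol a)=\sum_{i\in\mathrm{Des}(\boldsymbol a)}(n-i)$. Let $$\Pi(\mathrm S_n)=\bigl\{\sigma_1^{\gamma_1}\dotsb\sigma_n^{\gamma_n} : \{\sigma_1,\dotsc,\sigma_n\}=\{1,\dotsc,n\},\ \gamma_i\in\{0,\sigma_i\}\text{ for } i=1,\dotsc,n\bigr\}.$$ Let $d_1,\dotsc,d_n,e_1,\dotsc,e_n$ be non-negative integers and $\delta$ an integer with $d_1-e_1=\dotsb=d_n-e_n=\delta$. Define $\alpha\colon\{0,1,2,\dotsc\}\to\{\pm X^k:k\in\mathbb Z\}$ by $\alpha(i)=-X^{-d_i}$ for $i=1,\dotsc,n$ and $\alpha(c)=1$ otherwise; put $\alpha(\boldsymbol a)=\prod_{i=1}^n\alpha(\gamma_i)$ and let $\alpha_q(\boldsymbol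 a)$ be the value of $\alpha(\boldsymbol a)$ at $X=q$. Then $$\mathsf Z^{\mathrm{ask}}_{\mathrm{Mat}_{d_1\times e_1}(\mathfrak O)\oplus\dotsb\oplus\mathrm{Mat}_{d_n\times e_n}(\mathfrak O)}(Y)=\frac{\sum_{\boldsymbol a\in\Pi(\mathrm S_n)}\alpha_q(\boldsymbol a)\,q^{\delta\,\mathrm{comaj}(\boldsymbol a)}\,Y^{\mathrm{des}(\boldsymbol a)}}{(1-Y)(1-q^{\delta}Y)\dotsb(1-q^{n\delta}Y)}.$$ -/

import Mathlib

open scoped PowerSeries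

namespace AskHadamard

/-! ### Coloured permutations -/

/-- The poset of colours `Γ = {0 > 1 > 2 > ⋯}`. -/
abbrev Colour : Type := ℕᵒᵈ

/-- The colour with number `c`. -/
def colour (c : ℕ) : Colour := OrderDual.toDual c

/-- A coloured permutation `σ₁^{γ₁} ⋯ σₙ^{γₙ}` of length `n`: the symbols `σᵢ` are distinct positive
integers, the colours `γᵢ` are arbitrary. Positions are numbered by `Fin n`, starting at `0`. -/
structure ColouredPerm (n : ℕ) where
  /-- the symbols -/
  σ : Fin n ↪ ℕ+
  /-- the colours -/
  γ : Fin n → Colour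

namespace ColouredPerm

variable {n : ℕ}

/-- The coloured letter at a position. Coloured positive integers carry the colour order, which is
the left lexicographic order on `Γ × {1 < 2 < ⋯}`. -/
def letter (a : ColouredPerm n) (j : Fin n) : Colour ×ₗ ℕ+ := toLex (a.γ j, a.σ j)

/-- The descent set, as a set of integers in `{0, …, n - 1}`: for `1 ≤ i ≤ n - 1` it contains `i` if
the `i`th letter is larger than the `(i + 1)`st (which stand at positions `i - 1` and `i` of
`Fin n`), and it contains `0` if the first letter exists and has nonzero colour. -/
def Des (a : ColouredPerm n) : Finset ℕ :=
  ({j : Fin n | (j.val = 0 ∧ a.γ j ≠ colour 0) ∨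
    ∃ k : Fin n, k.val + 1 = j.val ∧ a.letter k > a.letter j} : Finset (Fin n)).map
    Fin.valEmbedding

/-- The descent number. -/
def des (a : ColouredPerm n) : ℕ := a.Des.card

/-- The comajor index `∑_{i ∈ Des(a)} (n - i)`; every `i` in the descent set is less than `n`. -/
def comaj (a : ColouredPerm n) : ℕ := ∑ i ∈ a.Des, (n - i)

end ColouredPerm

/-- The symmetric group `Sₙ`, as the set of words `σ₁ ⋯ σₙ` with `{σ₁, …, σₙ} = {1, …, n}`. -/
def symmetricWords (n : ℕ) : Set (Fin n ↪ ℕ+) :=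
  {σ | Set.range σ = {m : ℕ+ | (m : ℕ) ≤ n}}

/-- For a set `P` of (uncoloured) permutations, `Π(P)` is the set of all `σ₁^{γ₁} ⋯ σₙ^{γₙ}` with
`σ₁ ⋯ σₙ ∈ P` and `γᵢ ∈ {0, σᵢ}`. -/
def colourings {n : ℕ} (P : Set (Fin n ↪ ℕ+)) : Set (ColouredPerm n) :=
  {a | a.σ ∈ P ∧ ∀ j, a.γ j = colour 0 ∨ a.γ j = colour (a.σ j)}

theorem finite_colourings_symmetricWords (n : ℕ) : (colourings (symmetricWords n)).Finite := by
  have hN : ({m : ℕ+ | (m : ℕ) ≤ n}).Finite :=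
    (Set.finite_Iic n).preimage PNat.coe_injective.injOn
  have hC : ((fun c : ℕ => colour c) '' Set.Iic n).Finite := (Set.finite_Iic n).image _
  have hinj : Function.Injective
      (fun a : ColouredPerm n => ((fun j => (a.σ j, a.γ j)) : Fin n → ℕ+ × Colour)) := by
    rintro ⟨s, g⟩ ⟨s', g'⟩ h
    have h1 : ∀ j, (s j, g j) = (s' j, g' j) := fun j => congrFun h j
    simp only [Prod.mk.injEq] at h1
    have hs : s = s' := by ext j; rw [(h1 j).1]
    have hg : g = g' := funext fun j => (h1 j).2
    rw [hs, hg]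
  refine Set.Finite.subset
    ((Set.Finite.pi' (fun _ : Fin n => hN.prod hC)).preimage hinj.injOn) ?_
  rintro a ⟨hs, hg⟩ j
  have hs' : Set.range a.σ = {m : ℕ+ | (m : ℕ) ≤ n} := hs
  have hj : ((a.σ j : ℕ+) : ℕ) ≤ n := by
    have : a.σ j ∈ Set.range a.σ := ⟨j, rfl⟩
    rw [hs'] at this
    exact this
  refine ⟨hj, ?_⟩
  rcases hg j with h | h
  · exact ⟨0, Nat.zero_le _, h.symm⟩
  · exact ⟨_, hj, h.symm⟩

/-- `Π(Sₙ)` as a finite set. -/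
noncomputable def PiS (n : ℕ) : Finset (ColouredPerm n) :=
  (finite_colourings_symmetricWords n).toFinset

/-! ### Labels -/

/-- The variable `X`, as a unit of the field `ℚ(X)`. -/
noncomputable def unitX : (RatFunc ℚ)ˣ := Units.mk0 RatFunc.X RatFunc.X_ne_zero

/-- The subgroup `𝕌 = {± X ^ k : k ∈ ℤ}` of the multiplicative group of `ℚ(X)`. -/
noncomputable def labelGroup : Subgroup (RatFunc ℚ)ˣ where
  carrier := {u | ∃ k : ℤ, u = unitX ^ k ∨ u = -unitX ^ k}
  one_mem' := ⟨0, Or.inl (zpow_zero _).symm⟩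
  mul_mem' := by
    rintro _ _ ⟨k, rfl | rfl⟩ ⟨l, rfl | rfl⟩ <;> refine ⟨k + l, ?_⟩ <;> simp [zpow_add]
  inv_mem' := by
    rintro _ ⟨k, rfl | rfl⟩ <;> refine ⟨-k, ?_⟩ <;> simp [zpow_neg]

/-- `α(a) = ∏ᵢ α(γᵢ)`. -/
noncomputable def label (α : Colour → labelGroup) {n : ℕ} (a : ColouredPerm n) : labelGroup :=
  ∏ j, α (a.γ j)

/-- `α_q(a)`, the value of the rational function `α(a)` at `X = q`. -/
noncomputable def labelAt (α : Colour → labelGroup) (q : ℚ) {n : ℕ} (a : ColouredPerm n) : ℚ :=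
  RatFunc.eval (RingHom.id ℚ) q ((label α a : (RatFunc ℚ)ˣ) : RatFunc ℚ)

/-! ### Ask zeta functions -/

section Ask

variable {O : Type*} [CommRing O] [IsLocalRing O]

/-- The reduction of a module `M` of matrices modulo the `k`th power of the maximal ideal. -/
def reduction {m n : Type*} (M : Submodule O (Matrix m n O)) (k : ℕ) :
    Set (Matrix m n (O ⧸ IsLocalRing.maximalIdeal O ^ k)) :=
  (fun A => A.map (Ideal.Quotient.mk (IsLocalRing.maximalIdeal O ^ k))) '' (M : Set (Matrix m n O))

/-- The average size of the kernels of the matrices in the reduction of `M` modulo the `k`th power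
of the maximal ideal; a matrix acts on row vectors by right multiplication. (All these sets are
finite when the residue field is finite and `O` is Noetherian.) -/
noncomputable def averageKernelSize {m n : Type*} [Fintype m]
    (M : Submodule O (Matrix m n O)) (k : ℕ) : ℚ :=
  (∑ᶠ A ∈ reduction M k,
    (Nat.card {x : m → O ⧸ IsLocalRing.maximalIdeal O ^ k // Matrix.vecMul x A = 0} : ℚ)) /
    (Nat.card (reduction M k) : ℚ)

/-- The (local) ask zeta function of a module of matrices. -/
noncomputable def askZeta {m n : Type*} [Fintype m] (M : Submodule O (Matrix m n O)) : ℚ⟦X⟧ :=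
  PowerSeries.mk fun k => averageKernelSize M k

end Ask

/-- The diagonal direct sum of modules of matrices: all block diagonal matrices whose `i`th diagonal
block belongs to `M i`. -/
def diagonalDirectSum {O : Type*} [CommRing O] {ι : Type*} [DecidableEq ι] {m n : ι → Type*}
    (M : ∀ i, Submodule O (Matrix (m i) (n i) O)) :
    Submodule O (Matrix (Σ i, m i) (Σ i, n i) O) where
  carrier := {B | ∃ A : ∀ i, Matrix (m i) (n i) O,
    (∀ i, A i ∈ M i) ∧ B = Matrix.blockDiagonal' A}
  zero_mem' := ⟨0, fun i => (M i).zero_mem, Matrix.blockDiagonal'_zero.symm⟩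
  add_mem' := by
    rintro _ _ ⟨A, hA, rfl⟩ ⟨B, hB, rfl⟩
    exact ⟨A + B, fun i => (M i).add_mem (hA i) (hB i), (Matrix.blockDiagonal'_add A B).symm⟩
  smul_mem' := by
    rintro c _ ⟨A, hA, rfl⟩
    exact ⟨c • A, fun i => (M i).smul_mem c (hA i), (Matrix.blockDiagonal'_smul c A).symm⟩

end AskHadamard

/-! Fix `k`, let R = O/P^k and Q = q^δ. Kernels of block diagonal matrices are products of kernels
of the blocks, so the `k`th coefficient is a product of averages over full matrix modules. For one
block, a row vector x is killed by a proportion |I(x)|^(-e) of all matrices, where I(x) is the ideal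
generated by its entries. The ideals of R form a chain of sizes 1, q, ..., q^k, and grouping vectors
by I(x) gives the average (Q^0 + ... + Q^k) - q^(-d)(Q^1 + ... + Q^k)
(`average_card_vecMul_eq_zero_of_chain`).

Expanding the product over `i`, choose one of the two sums in each factor (zero or nonzero colour of
the symbol `i + 1`) and an exponent `t i` from that sum. Sorting the symbols by (`t i`, coloured
letter) lexicographically produces exactly one coloured permutation `a`, and the sorted exponents
are the weakly increasing sequences bounded by `k` that jump at each descent of `a`
(`strictMono_toLex_letter_iff`, `sum_PiS_gapSequences`). Their generating function is Q^comaj Y^des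
over the common denominator (`mk_sum_gapSequences_mul`), and summing over `a` gives the formula. -/

namespace AskHadamard

/-! ### Generating functions of bounded sequences with prescribed minimal gaps -/

section Sequences

open Finset

/-- The sequences of natural numbers bounded by `k` whose successive gaps (the first one being
measured from `0`) are bounded below by `D`. -/
def gapSequences {n : ℕ} (D : Fin n → ℕ) (k : ℕ) : Finset (Fin n → ℕ) :=
  {j ∈ Fintype.piFinset fun _ : Fin n => range (k + 1) |
    (∀ i, D i ≤ j i) ∧ ∀ i i', i < i' → j i + D i' ≤ j i'}

theorem mem_gapSequences {n : ℕ} {D : Fin n → ℕ} {k : ℕ} {j : Fin n → ℕ} :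
    j ∈ gapSequences D k ↔
      (∀ i, j i ≤ k) ∧ (∀ i, D i ≤ j i) ∧ ∀ i i', i < i' → j i + D i' ≤ j i' := by
  simp [gapSequences, Fintype.mem_piFinset]

/-- Peels off the last, largest entry: the required final gap turns into a smaller upper bound for
the others. -/
theorem snoc_mem_gapSequences {n : ℕ} {D : Fin (n + 1) → ℕ} {k x : ℕ} {j : Fin n → ℕ} :
    (Fin.snoc j x : Fin (n + 1) → ℕ) ∈ gapSequences D k ↔
      x ∈ Icc (D (Fin.last n)) k ∧
        j ∈ gapSequences (fun i => D i.castSucc) (x - D (Fin.last n)) := by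
  simp only [mem_gapSequences, Fin.forall_fin_succ', Fin.snoc_castSucc, Fin.snoc_last, mem_Icc,
    Fin.castSucc_lt_castSucc_iff, Fin.castSucc_lt_last, lt_irrefl, forall_true_left,
    fun i : Fin n => (Fin.castSucc_lt_last i).not_gt, false_imp_iff,
    and_true, implies_true]
  constructor
  · rintro ⟨⟨_, hx⟩, ⟨h1, h2⟩, h3⟩
    exact ⟨⟨h2, hx⟩, fun i => by have := (h3 i).2; omega, h1, fun i => (h3 i).1⟩
  · rintro ⟨⟨h2, hx⟩, h1, h3, h4⟩
    exact ⟨⟨fun i => by have := h1 i; omega, hx⟩, ⟨h3, h2⟩,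
      fun i => ⟨h4 i, by have := h1 i; omega⟩⟩

theorem sum_gapSequences_succ {M : Type*} [AddCommMonoid M] {n : ℕ} (D : Fin (n + 1) → ℕ) (k : ℕ)
    (f : (Fin (n + 1) → ℕ) → M) :
    ∑ j ∈ gapSequences D k, f j =
      ∑ x ∈ Icc (D (Fin.last n)) k,
        ∑ j ∈ gapSequences (fun i => D i.castSucc) (x - D (Fin.last n)), f (Fin.snoc j x) := by
  rw [sum_sigma']
  refine sum_bij' (fun j _ => ⟨j (Fin.last n), Fin.init j⟩) (fun p _ => Fin.snoc p.2 p.1)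
    ?_ ?_ ?_ ?_ ?_
  · intro j hj
    rw [← Fin.snoc_init_self j, snoc_mem_gapSequences] at hj
    simpa [Fin.init] using hj
  · intro p hp
    exact snoc_mem_gapSequences.2 (mem_sigma.1 hp)
  · intro j _
    exact Fin.snoc_init_self j
  · rintro ⟨x, j⟩ _
    simp
  · intro j _
    rw [Fin.snoc_init_self]

/-- Multiplication by 1 - Y takes differences of consecutive coefficients, which leaves only the
term `x = k`. -/
theorem mk_sum_Icc_mul_one_sub_X (Q : ℚ) (d : ℕ) (g : ℕ → ℚ) :
    (PowerSeries.mk fun k => ∑ x ∈ Icc d k, Q ^ x * g (x - d)) * (1 - PowerSeries.X) =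
      (PowerSeries.C Q * PowerSeries.X) ^ d * PowerSeries.rescale Q (PowerSeries.mk g) := by
  ext k
  rw [mul_sub, mul_one, map_sub, mul_pow, ← map_pow, mul_assoc, PowerSeries.coeff_C_mul,
    PowerSeries.coeff_X_pow_mul', PowerSeries.coeff_mk, PowerSeries.rescale_mk]
  cases k with
  | zero =>
    rcases Nat.eq_zero_or_pos d with rfl | h
    · simp
    · simp [Nat.not_le.2 h, Icc_eq_empty (Nat.not_le.2 h)]
  | succ k =>
    rw [PowerSeries.coeff_succ_mul_X, PowerSeries.coeff_mk]
    split_ifs with h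
    · rw [sum_Icc_succ_top h, add_sub_cancel_left, PowerSeries.coeff_mk, ← mul_assoc, ← pow_add,
        Nat.add_sub_cancel' h]
    · rw [Icc_eq_empty h, Icc_eq_empty (by omega)]
      simp

theorem rescale_C_mul_X (Q a : ℚ) :
    PowerSeries.rescale Q (PowerSeries.C a * PowerSeries.X) =
      PowerSeries.C (a * Q) * PowerSeries.X := by
  ext k
  rw [PowerSeries.coeff_rescale, PowerSeries.coeff_C_mul, PowerSeries.coeff_C_mul,
    PowerSeries.coeff_X]
  split_ifs with h
  · simp [h, mul_comm]
  · simp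

/-- Removing the last entry costs a factor 1 - Y and rescales the rest by Y ↦ QY, so induction
applies. The exponent `n - i` counts the entries from position `i` on, all of which move up when the
gap `D i` grows by one. -/
theorem mk_sum_gapSequences_mul (Q : ℚ) {n : ℕ} (D : Fin n → ℕ) :
    (PowerSeries.mk fun k => ∑ j ∈ gapSequences D k, ∏ i, Q ^ j i) *
        ∏ i ∈ range (n + 1), (1 - PowerSeries.C (Q ^ i) * PowerSeries.X) =
      ∏ i : Fin n, (PowerSeries.C (Q ^ (n - i)) * PowerSeries.X) ^ D i := by
  induction n with
  | zero =>
    have h : ∀ k, gapSequences D k = univ := fun k => by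
      ext j
      simp [eq_iff_true_of_subsingleton, mem_gapSequences]
    ext k
    cases k with
    | zero => simp [h]
    | succ k => simp [h, mul_sub, PowerSeries.coeff_succ_mul_X, PowerSeries.coeff_one]
  | succ n ih =>
    have h1 : (PowerSeries.mk fun k => ∑ j ∈ gapSequences D k, ∏ i, Q ^ j i) *
        (1 - PowerSeries.X) = (PowerSeries.C Q * PowerSeries.X) ^ D (Fin.last n) *
          PowerSeries.rescale Q (PowerSeries.mk fun k =>
            ∑ j ∈ gapSequences (fun i : Fin n => D i.castSucc) k, ∏ i, Q ^ j i) := by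
      rw [← mk_sum_Icc_mul_one_sub_X]
      congr 2
      funext k
      rw [sum_gapSequences_succ]
      simp [Fin.prod_univ_castSucc, mul_sum, mul_comm]
    have h2 : ∏ i ∈ range (n + 1), (1 - PowerSeries.C (Q ^ (i + 1)) * PowerSeries.X) =
        PowerSeries.rescale Q
          (∏ i ∈ range (n + 1), (1 - PowerSeries.C (Q ^ i) * PowerSeries.X)) := by
      rw [map_prod]
      refine prod_congr rfl fun i _ => ?_
      rw [map_sub, map_one, rescale_C_mul_X, ← pow_succ]
    rw [prod_range_succ', pow_zero, map_one, one_mul, mul_comm (∏ i ∈ _, _), ← mul_assoc, h1, h2, mul_assoc, ← map_mul, ih, Fin.prod_univ_castSucc, map_prod,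
      mul_comm]
    congr 1
    · refine prod_congr rfl fun i _ => ?_
      rw [map_pow, rescale_C_mul_X, ← pow_succ, Fin.val_castSucc, Nat.sub_add_comm i.2.le]
    · simp

end Sequences

/-! ### Evaluation of labels -/

section Labels

/-- `RatFunc.eval` is multiplicative only where denominators do not vanish; here they divide a power
of X. -/
theorem denom_unitX_zpow_eval_ne_zero {q : ℚ} (hq : q ≠ 0) (k : ℤ) :
    Polynomial.eval₂ (RingHom.id ℚ) q (RatFunc.denom ((unitX ^ k : (RatFunc ℚ)ˣ) : RatFunc ℚ)) ≠
      0 := by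
  have h : ∃ m : ℕ, RatFunc.denom ((unitX ^ k : (RatFunc ℚ)ˣ) : RatFunc ℚ) ∣
      (Polynomial.X : Polynomial ℚ) ^ m := by
    obtain ⟨m, rfl | rfl⟩ := k.eq_nat_or_neg
    · refine ⟨0, (RatFunc.denom_dvd (pow_ne_zero _ Polynomial.X_ne_zero)).2
        ⟨Polynomial.X ^ m, ?_⟩⟩
      simp [unitX]
    · refine ⟨m, (RatFunc.denom_dvd (pow_ne_zero _ Polynomial.X_ne_zero)).2 ⟨1, ?_⟩⟩
      simp [unitX]
  obtain ⟨m, h⟩ := h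
  intro h0
  have := Polynomial.eval₂_eq_zero_of_dvd_of_eval₂_eq_zero (RingHom.id ℚ) q h h0
  simp [hq] at this

theorem labelGroup_denom_eval_ne_zero {q : ℚ} (hq : q ≠ 0) (u : labelGroup) :
    Polynomial.eval₂ (RingHom.id ℚ) q (RatFunc.denom ((u : (RatFunc ℚ)ˣ) : RatFunc ℚ)) ≠ 0 := by
  obtain ⟨_, k, rfl | rfl⟩ := u
  · exact denom_unitX_zpow_eval_ne_zero hq k
  · have h : RatFunc.denom (((-unitX ^ k : (RatFunc ℚ)ˣ)) : RatFunc ℚ) ∣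
        RatFunc.denom ((unitX ^ k : (RatFunc ℚ)ˣ) : RatFunc ℚ) := by
      rw [RatFunc.denom_dvd (RatFunc.denom_ne_zero _)]
      refine ⟨-RatFunc.num ((unitX ^ k : (RatFunc ℚ)ˣ) : RatFunc ℚ), ?_⟩
      rw [map_neg, neg_div, RatFunc.num_div_denom, Units.val_neg]
    intro h0
    exact denom_unitX_zpow_eval_ne_zero hq k
      (Polynomial.eval₂_eq_zero_of_dvd_of_eval₂_eq_zero (RingHom.id ℚ) q h h0)

/-- The evaluation of labels at a nonzero rational number. -/
noncomputable def labelEval (q : ℚ) (hq : q ≠ 0) : labelGroup →* ℚ where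
  toFun u := RatFunc.eval (RingHom.id ℚ) q ((u : (RatFunc ℚ)ˣ) : RatFunc ℚ)
  map_one' := by simp
  map_mul' u v := by
    rw [Subgroup.coe_mul, Units.val_mul]
    exact RatFunc.eval_mul _ _ (labelGroup_denom_eval_ne_zero hq u)
      (labelGroup_denom_eval_ne_zero hq v)

theorem labelAt_eq_prod (α : Colour → labelGroup) {q : ℚ} (hq : q ≠ 0) {n : ℕ}
    (a : ColouredPerm n) : labelAt α q a = ∏ j, labelEval q hq (α (a.γ j)) := by
  rw [← map_prod]
  rfl

theorem labelEval_eq {q : ℚ} (hq : q ≠ 0) {u : labelGroup} {m : ℕ}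
    (hu : ((u : (RatFunc ℚ)ˣ) : RatFunc ℚ) = -(RatFunc.X : RatFunc ℚ) ^ (-(m : ℤ))) :
    labelEval q hq u = -(q ^ m)⁻¹ := by
  -- Clearing the denominator reduces the evaluation to polynomials.
  have h1 : ((u : (RatFunc ℚ)ˣ) : RatFunc ℚ) * algebraMap (Polynomial ℚ) _ (Polynomial.X ^ m) =
      algebraMap (Polynomial ℚ) _ (-1) := by
    rw [hu]
    simp [RatFunc.X_ne_zero]
  have h2 := congrArg (RatFunc.eval (RingHom.id ℚ) q) h1
  rw [RatFunc.eval_mul _ _ (labelGroup_denom_eval_ne_zero hq u)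
    (by rw [RatFunc.denom_algebraMap]; simp)] at h2
  simp only [RatFunc.eval_algebraMap, Algebra.algebraMap_self, RingHom.id_apply,
    Polynomial.eval₂_X_pow, Polynomial.eval₂_neg, Polynomial.eval₂_one] at h2
  rw [← neg_one_mul, eq_mul_inv_iff_mul_eq₀ (pow_ne_zero m hq)]
  exact h2

end Labels

end AskHadamard

namespace AskHadamard

/-! ### Coloured permutations and sorting -/

section Sorting

open Finset

/-- The indicator function of the descent set. -/
def descentGap {n : ℕ} (a : ColouredPerm n) (i : Fin n) : ℕ := if (i : ℕ) ∈ a.Des then 1 else 0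

theorem ColouredPerm.mem_Des {n : ℕ} {a : ColouredPerm n} {j : Fin n} :
    (j : ℕ) ∈ a.Des ↔ (j.val = 0 ∧ a.γ j ≠ colour 0) ∨
      ∃ k : Fin n, k.val + 1 = j.val ∧ a.letter k > a.letter j := by
  simp only [Des, mem_map, mem_filter, mem_univ, true_and, Fin.valEmbedding_apply]
  constructor
  · rintro ⟨i, hi, hij⟩
    rwa [← Fin.ext hij]
  · exact fun h => ⟨j, h, rfl⟩

theorem sum_descentGap {n : ℕ} (a : ColouredPerm n) (f : ℕ → ℕ) :
    ∑ i : Fin n, descentGap a i * f i = ∑ i ∈ a.Des, f i := by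
  have h : a.Des = (univ.filter fun i : Fin n => (i : ℕ) ∈ a.Des).map Fin.valEmbedding := by
    ext m
    simp only [mem_map, mem_filter, mem_univ, true_and, Fin.valEmbedding_apply]
    constructor
    · intro hm
      obtain ⟨i, _, rfl⟩ := mem_map.1 hm
      exact ⟨i, hm, rfl⟩
    · rintro ⟨i, hi, rfl⟩
      exact hi
  rw [h, sum_map, sum_filter]
  simp [descentGap]

theorem ColouredPerm.letter_injective {n : ℕ} (a : ColouredPerm n) :
    Function.Injective a.letter := fun i j h => by
  have h' : (a.γ i, a.σ i) = (a.γ j, a.σ j) := toLex.injective h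
  exact a.σ.injective (Prod.ext_iff.1 h').2

/-- In lexicographic order a tie in `s` is allowed exactly where the letters ascend, so `s` must
jump at each descent. The descent at 0 encodes the lower bound 1 at letters of nonzero colour. -/
theorem strictMono_toLex_letter_iff {n : ℕ} (a : ColouredPerm n) (s : Fin n → ℕ) :
    (StrictMono (fun i => (toLex (s i, a.letter i) : ℕ ×ₗ (Colour ×ₗ ℕ+))) ∧
        ∀ i, a.γ i ≠ colour 0 → 1 ≤ s i) ↔
      (∀ i, descentGap a i ≤ s i) ∧ ∀ i i', i < i' → s i + descentGap a i' ≤ s i' := by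
  constructor
  · rintro ⟨hL, h0⟩
    have hs : Monotone s := fun i j hij => by
      have := hL.monotone hij
      rw [Prod.Lex.toLex_le_toLex] at this
      rcases this with h | h
      · exact h.le
      · exact h.1.le
    have hd : ∀ k i : Fin n, k.val + 1 = i.val → a.letter k > a.letter i → s k < s i := by
      intro k i hki hgt
      have := hL (show k < i from Fin.lt_def.2 (by omega))
      rw [Prod.Lex.toLex_lt_toLex] at this
      rcases this with h | h
      · exact h
      · exact absurd h.2 hgt.le.not_gt
    refine ⟨fun i => ?_, fun i i' hii => ?_⟩
    · unfold descentGap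
      split_ifs with h
      · rcases ColouredPerm.mem_Des.1 h with h | ⟨k, hk, hgt⟩
        · exact h0 i h.2
        · have := hd k i hk hgt
          omega
      · omega
    · unfold descentGap
      split_ifs with h
      · rcases ColouredPerm.mem_Des.1 h with h | ⟨k, hk, hgt⟩
        · have := Fin.lt_def.1 hii
          omega
        · have h1 := hd k i' hk hgt
          have h2 : s i ≤ s k := hs (Fin.le_def.2 (by have := Fin.lt_def.1 hii; omega))
          omega
      · exact hs hii.le
  · rintro ⟨h0, hD⟩
    have hL : StrictMono (fun i => (toLex (s i, a.letter i) : ℕ ×ₗ (Colour ×ₗ ℕ+))) := by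
      cases n with
      | zero => exact fun i => i.elim0
      | succ n =>
        refine Fin.strictMono_iff_lt_succ.2 fun i => ?_
        rw [Prod.Lex.toLex_lt_toLex]
        have h := hD i.castSucc i.succ Fin.castSucc_lt_succ
        unfold descentGap at h
        split_ifs at h with hm
        · left
          dsimp only
          omega
        · rcases Nat.lt_or_eq_of_le (Nat.le_of_add_right_le h) with h | h
          · exact Or.inl h
          · refine Or.inr ⟨h, ?_⟩
            rw [ColouredPerm.mem_Des, not_or] at hm
            refine lt_of_le_of_ne (not_lt.1 fun hlt => hm.2 ⟨i.castSucc, by simp, hlt⟩) ?_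
            exact fun he => Fin.castSucc_lt_succ.ne (a.letter_injective he)
    refine ⟨hL, fun i hi => ?_⟩
    by_contra hlt
    have hsi : s i = 0 := by omega
    -- If `s i = 0`, then `s` vanishes at the first position too, so the first letter has colour 0.
    -- This is the greatest colour and the letters do not decrease from there to `i`, so `i` has
    -- colour 0 as well.
    obtain ⟨z, hz⟩ : ∃ z : Fin n, z.val = 0 := ⟨⟨0, i.pos⟩, rfl⟩
    have hzi := hL.monotone (show z ≤ i from Fin.le_def.2 (by omega))
    rw [Prod.Lex.toLex_le_toLex] at hzi
    rcases hzi with h | ⟨h, hle⟩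
    · dsimp only at h
      omega
    · dsimp only at h hle
      have hgz := h0 z
      unfold descentGap at hgz
      have hγz : a.γ z = colour 0 := by
        by_contra hne
        rw [if_pos (ColouredPerm.mem_Des.2 (Or.inl ⟨hz, hne⟩))] at hgz
        omega
      have hγ : a.γ z ≤ a.γ i := by
        unfold ColouredPerm.letter at hle
        rw [Prod.Lex.toLex_le_toLex] at hle
        rcases hle with h | h
        · exact h.le
        · exact h.1.le
      rw [hγz] at hγ
      have h2 : OrderDual.ofDual (a.γ i) ≤ 0 := hγ
      exact hi (congrArg OrderDual.toDual (Nat.le_zero.1 h2))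

theorem existsUnique_perm_strictMono {n : ℕ} {β : Type*} [LinearOrder β] {f : Fin n → β}
    (hf : Function.Injective f) : ∃! π : Equiv.Perm (Fin n), StrictMono (f ∘ π) := by
  refine ⟨Tuple.sort f,
    (Tuple.monotone_sort f).strictMono_of_injective (hf.comp (Tuple.sort f).injective), ?_⟩
  intro π hπ
  have h := StrictMono.range_inj hπ
    ((Tuple.monotone_sort f).strictMono_of_injective (hf.comp (Tuple.sort f).injective))
    |>.1 (by simp [Set.range_comp])
  ext i
  rw [hf (congrFun h i)]

/-- The element of `Π(Sₙ)` with underlying permutation `π` in which the symbol `i + 1` has nonzero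
colour if and only if `c i` is true. -/
def colouredPermOf {n : ℕ} (π : Equiv.Perm (Fin n)) (c : Fin n → Bool) : ColouredPerm n where
  σ := ⟨fun j => Nat.succPNat (π j), fun _ _ h =>
    π.injective (Fin.ext (Nat.succPNat_injective h))⟩
  γ j := if c (π j) then colour (π j + 1) else colour 0

theorem colouredPermOf_σ {n : ℕ} (π : Equiv.Perm (Fin n)) (c : Fin n → Bool) (j : Fin n) :
    (colouredPermOf π c).σ j = Nat.succPNat (π j) := rfl

theorem colouredPermOf_γ {n : ℕ} (π : Equiv.Perm (Fin n)) (c : Fin n → Bool) (j : Fin n) :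
    (colouredPermOf π c).γ j = if c (π j) then colour (π j + 1) else colour 0 := rfl

theorem colour_injective : Function.Injective colour := OrderDual.toDual.injective

theorem ColouredPerm.ext' {n : ℕ} {a b : ColouredPerm n} (h1 : ∀ j, a.σ j = b.σ j)
    (h2 : ∀ j, a.γ j = b.γ j) : a = b := by
  obtain ⟨s, g⟩ := a
  obtain ⟨s', g'⟩ := b
  congr
  · exact DFunLike.ext _ _ h1
  · exact funext h2

theorem sum_PiS {M : Type*} [AddCommMonoid M] {n : ℕ} (f : ColouredPerm n → M) :
    ∑ a ∈ PiS n, f a = ∑ π : Equiv.Perm (Fin n), ∑ c : Fin n → Bool, f (colouredPermOf π c) := by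
  rw [← Fintype.sum_prod_type', eq_comm]
  refine sum_bij (fun p _ => colouredPermOf p.1 p.2) ?_ ?_ ?_ (fun _ _ => rfl)
  · rintro ⟨π, c⟩ _
    rw [PiS, Set.Finite.mem_toFinset]
    refine ⟨?_, fun j => ?_⟩
    · ext m
      simp only [Set.mem_range, colouredPermOf_σ, Set.mem_ofPred_eq]
      constructor
      · rintro ⟨j, rfl⟩
        rw [Nat.succPNat_coe]
        exact (π j).2
      · intro hm
        have := m.pos
        refine ⟨π.symm ⟨m - 1, by omega⟩, PNat.coe_injective ?_⟩
        rw [Equiv.apply_symm_apply, Nat.succPNat_coe]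
        dsimp only
        omega
    · dsimp only [colouredPermOf]
      split_ifs
      · exact Or.inr rfl
      · exact Or.inl rfl
  · rintro ⟨π, c⟩ _ ⟨π', c'⟩ _ h
    have hπ : π = π' := by
      ext j
      have := congrArg (fun a => (a.σ j : ℕ)) h
      simpa [colouredPermOf_σ] using this
    subst hπ
    have hc : c = c' := by
      funext i
      have := congrArg (fun a => a.γ (π.symm i)) h
      simp only [colouredPermOf_γ, Equiv.apply_symm_apply] at this
      cases h1 : c i <;> cases h2 : c' i <;> simp [h1, h2, colour_injective.eq_iff] at this ⊢
    rw [hc]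
  · intro a ha
    rw [PiS, Set.Finite.mem_toFinset] at ha
    obtain ⟨hσ, hγ⟩ := ha
    have hle : ∀ j, (a.σ j : ℕ) ≤ n := fun j => by
      have h : a.σ j ∈ Set.range a.σ := ⟨j, rfl⟩
      rw [show Set.range a.σ = _ from hσ] at h
      exact h
    have hpos : ∀ j, 0 < (a.σ j : ℕ) := fun j => (a.σ j).pos
    let g : Fin n → Fin n := fun j => ⟨a.σ j - 1, by have := hle j; have := hpos j; omega⟩
    have hg : Function.Injective g := fun i j h => by
      have h' := Fin.ext_iff.1 h
      dsimp only [g] at h'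
      have := hpos i
      have := hpos j
      exact a.σ.injective (PNat.coe_injective (by omega))
    let π : Equiv.Perm (Fin n) := Equiv.ofBijective g (Finite.injective_iff_bijective.1 hg)
    have hπ : ∀ j, (π j : ℕ) + 1 = a.σ j := fun j => by
      have := hpos j
      change (a.σ j : ℕ) - 1 + 1 = _
      omega
    -- The flags are indexed by symbols rather than positions, hence `π.symm`.
    refine ⟨(π, fun i => decide (a.γ (π.symm i) ≠ colour 0)), mem_univ _,
      ColouredPerm.ext' (fun j => ?_) fun j => ?_⟩
    · exact PNat.coe_injective (hπ j)
    · simp only [colouredPermOf_γ, Equiv.symm_apply_apply, hπ]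
      rcases hγ j with h | h
      · simp [h]
      · rw [h]
        simp [colour_injective.eq_iff]

/-- The coloured letter with symbol `i + 1`. -/
def letterOf {n : ℕ} (c : Fin n → Bool) (i : Fin n) : Colour ×ₗ ℕ+ :=
  toLex (if c i then colour (i + 1) else colour 0, Nat.succPNat i)

theorem letterOf_injective {n : ℕ} (c : Fin n → Bool) : Function.Injective (letterOf c) :=
  fun _ _ h => Fin.ext (Nat.succPNat_injective (Prod.ext_iff.1 (toLex.injective h)).2)

theorem comp_mem_gapSequences_iff {n : ℕ} (π : Equiv.Perm (Fin n)) (c : Fin n → Bool) (k : ℕ)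
    (t : Fin n → ℕ) :
    t ∘ π ∈ gapSequences (descentGap (colouredPermOf π c)) k ↔
      t ∈ Fintype.piFinset (fun i => Icc (if c i then 1 else 0) k) ∧
        StrictMono ((fun i => (toLex (t i, letterOf c i) : ℕ ×ₗ (Colour ×ₗ ℕ+))) ∘ π) := by
  rw [mem_gapSequences, ← strictMono_toLex_letter_iff, Fintype.mem_piFinset]
  have h1 : (∀ i, (t ∘ π) i ≤ k) ↔ ∀ i, t i ≤ k :=
    (π.surjective.forall (p := fun i => t i ≤ k)).symm
  have h2 : (∀ i, (colouredPermOf π c).γ i ≠ colour 0 → 1 ≤ (t ∘ π) i) ↔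
      ∀ i, (if c i then 1 else 0) ≤ t i := by
    rw [π.surjective.forall (p := fun i => (if c i then 1 else 0) ≤ t i)]
    refine forall_congr' fun i => ?_
    rw [colouredPermOf_γ, Function.comp_apply]
    cases c (π i) <;> simp [colour_injective.eq_iff]
  rw [h1, h2]
  simp only [mem_Icc, forall_and]
  exact ⟨fun h => ⟨⟨h.2.2, h.1⟩, h.2.1⟩, fun h => ⟨h.1.2, h.2, h.1.1⟩⟩

theorem sum_gapSequences_colouredPermOf {n : ℕ} (Q : ℚ) (π : Equiv.Perm (Fin n))
    (c : Fin n → Bool) (k : ℕ) :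
    ∑ s ∈ gapSequences (descentGap (colouredPermOf π c)) k, ∏ i, Q ^ s i =
      ∑ t ∈ Fintype.piFinset (fun i => Icc (if c i then 1 else 0) k),
        open Classical in
        if StrictMono ((fun i => (toLex (t i, letterOf c i) : ℕ ×ₗ (Colour ×ₗ ℕ+))) ∘ π)
        then ∏ i, Q ^ t i else 0 := by
  classical
  rw [← sum_filter]
  refine sum_bij' (fun s _ => s ∘ π.symm) (fun t _ => t ∘ π) ?_ ?_ ?_ ?_ ?_
  · intro s hs
    rw [mem_filter, ← comp_mem_gapSequences_iff]
    simpa [Function.comp_assoc] using hs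
  · intro t ht
    rwa [mem_filter, ← comp_mem_gapSequences_iff] at ht
  · intro s _
    simp [Function.comp_assoc]
  · intro t _
    simp [Function.comp_assoc]
  · intro s _
    exact (Equiv.prod_comp π.symm fun i => Q ^ s i).symm

/-- The flags `c` pick a summand in each factor on the right, and every pair (`c`, `t`) is sorted by
exactly one `π`; ties in `t` are broken by the distinct letters. -/
theorem sum_PiS_gapSequences {n : ℕ} (Q : ℚ) (v : Colour → ℚ) (hv : v (colour 0) = 1) (k : ℕ) :
    ∑ a ∈ PiS n, (∏ j, v (a.γ j)) * ∑ s ∈ gapSequences (descentGap a) k, ∏ i, Q ^ s i =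
      ∏ i : Fin n, (∑ j ∈ Icc 0 k, Q ^ j + v (colour (i + 1)) * ∑ j ∈ Icc 1 k, Q ^ j) := by
  classical
  have h1 : ∀ (π : Equiv.Perm (Fin n)) (c : Fin n → Bool),
      ∏ j, v ((colouredPermOf π c).γ j) = ∏ i, if c i then v (colour (i + 1)) else 1 :=
    fun π c => by
      rw [← Equiv.prod_comp π fun i => if c i then v (colour (i + 1)) else 1]
      refine prod_congr rfl fun j _ => ?_
      rw [colouredPermOf_γ]
      split_ifs
      · rfl
      · exact hv
  have h2 : ∀ (c : Fin n → Bool) (t : Fin n → ℕ), (∑ π : Equiv.Perm (Fin n),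
      if StrictMono ((fun i => (toLex (t i, letterOf c i) : ℕ ×ₗ (Colour ×ₗ ℕ+))) ∘ π)
        then ∏ i, Q ^ t i else 0) = ∏ i, Q ^ t i := fun c t => by
    have hf : Function.Injective
        (fun i => (toLex (t i, letterOf c i) : ℕ ×ₗ (Colour ×ₗ ℕ+))) := fun i j h =>
      letterOf_injective c (Prod.ext_iff.1 (toLex.injective h)).2
    obtain ⟨π, hπ, huniq⟩ := existsUnique_perm_strictMono hf
    rw [sum_eq_single π (fun ρ _ hne => if_neg fun h => hne (huniq ρ h)) (by simp), if_pos hπ]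
  rw [sum_PiS, sum_comm]
  simp_rw [h1, sum_gapSequences_colouredPermOf, ← mul_sum]
  have h3 : ∀ i : Fin n,
      ∑ j ∈ Icc 0 k, Q ^ j + v (colour (i + 1)) * ∑ j ∈ Icc 1 k, Q ^ j =
      ∑ b : Bool, (if b then v (colour (i + 1)) else 1) *
        ∑ j ∈ Icc (if b then 1 else 0) k, Q ^ j := fun i => by
    simp [add_comm]
  simp_rw [h3]
  rw [prod_univ_sum, Fintype.piFinset_univ]
  refine sum_congr rfl fun c _ => ?_
  rw [sum_comm, prod_mul_distrib, prod_univ_sum]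
  simp_rw [h2]

theorem mk_prod_mul_eq_sum_PiS {n : ℕ} (Q : ℚ) (v : Colour → ℚ) (hv : v (colour 0) = 1) :
    (PowerSeries.mk fun k =>
        ∏ i : Fin n, (∑ j ∈ Icc 0 k, Q ^ j + v (colour (i + 1)) * ∑ j ∈ Icc 1 k, Q ^ j)) *
        ∏ i ∈ range (n + 1), (1 - PowerSeries.C (Q ^ i) * PowerSeries.X) =
      ∑ a ∈ PiS n, PowerSeries.C ((∏ j, v (a.γ j)) * Q ^ a.comaj) * PowerSeries.X ^ a.des := by
  have h : (PowerSeries.mk fun k =>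
        ∏ i : Fin n, (∑ j ∈ Icc 0 k, Q ^ j + v (colour (i + 1)) * ∑ j ∈ Icc 1 k, Q ^ j)) =
      ∑ a ∈ PiS n, PowerSeries.C (∏ j, v (a.γ j)) *
        PowerSeries.mk fun k => ∑ s ∈ gapSequences (descentGap a) k, ∏ i, Q ^ s i := by
    ext k
    rw [map_sum, PowerSeries.coeff_mk, ← sum_PiS_gapSequences Q v hv]
    simp only [PowerSeries.coeff_C_mul, PowerSeries.coeff_mk]
  rw [h, sum_mul]
  refine sum_congr rfl fun a _ => ?_
  rw [mul_assoc, mk_sum_gapSequences_mul, map_mul, mul_assoc]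
  congr 1
  simp only [mul_pow, prod_mul_distrib, ← map_pow, ← map_prod, ← pow_mul, prod_pow_eq_pow_sum]
  congr 2
  · rw [ColouredPerm.comaj, ← sum_descentGap]
    simp only [mul_comm]
  · rw [ColouredPerm.des, card_eq_sum_ones, ← sum_descentGap]
    simp

end Sorting

end AskHadamard

namespace AskHadamard

/-! ### Average sizes of kernels over finite chain rings -/

section Average

open Finset Matrix

/-- The linear form y ↦ x · y has the ideal generated by the entries of `x` as its image. -/
theorem card_dotProduct_eq_zero_mul {R : Type*} [CommRing R] [Fintype R] {m : Type*} [Fintype m]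
    (x : m → R) :
    Nat.card {y : m → R // x ⬝ᵥ y = 0} * Nat.card (Ideal.span (Set.range x)) =
      Nat.card R ^ Fintype.card m := by
  have h := (LinearMap.ker (Fintype.linearCombination R x)).toAddSubgroup
    |>.card_eq_card_quotient_mul_card_addSubgroup
  have h1 : Nat.card ((m → R) ⧸ (LinearMap.ker (Fintype.linearCombination R x)).toAddSubgroup) =
      Nat.card (Ideal.span (Set.range x)) := by
    rw [Ideal.span, ← Fintype.range_linearCombination]
    exact Nat.card_congr (Fintype.linearCombination R x).quotKerEquivRange.toEquiv
  have h2 : Nat.card (LinearMap.ker (Fintype.linearCombination R x)).toAddSubgroup =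
      Nat.card {y : m → R // x ⬝ᵥ y = 0} := by
    refine Nat.card_congr (Equiv.subtypeEquivRight fun y => ?_)
    simp [Fintype.linearCombination_apply, dotProduct, mul_comm]
  rw [h1, h2] at h
  rw [mul_comm, ← h, Nat.card_fun, Nat.card_eq_fintype_card (α := m)]

/-- Double counting of pairs (`A`, `x`) with `x ᵥ* A = 0`: for fixed `x`, the columns of `A` are
chosen independently. -/
theorem sum_card_vecMul_eq_zero {R : Type*} [CommRing R] [Fintype R] {m n : Type*}
    [Fintype m] [Fintype n] [DecidableEq m] [DecidableEq n] :
    ∑ A : Matrix m n R, Nat.card {x : m → R // x ᵥ* A = 0} =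
      ∑ x : m → R, Nat.card {y : m → R // x ⬝ᵥ y = 0} ^ Fintype.card n := by
  have h : ∀ x : m → R, Nat.card {y : m → R // x ⬝ᵥ y = 0} ^ Fintype.card n =
      Nat.card {A : Matrix m n R // x ᵥ* A = 0} := fun x => by
    rw [← Nat.card_eq_fintype_card, ← Nat.card_fun]
    exact Nat.card_congr
      { toFun := fun f => ⟨of fun i j => (f j).1 i, funext fun j => (f j).2⟩
        invFun := fun A j => ⟨fun i => A.1 i j, congrFun A.2 j⟩
        left_inv := fun _ => rfl
        right_inv := fun _ => rfl }
  simp_rw [h]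
  rw [← Nat.card_sigma, ← Nat.card_sigma]
  exact Nat.card_congr
    { toFun := fun p => ⟨p.2.1, p.1, p.2.2⟩
      invFun := fun p => ⟨p.2.1, p.1, p.2.2⟩
      left_inv := fun _ => rfl
      right_inv := fun _ => rfl }

theorem average_card_vecMul_eq_zero {R : Type*} [CommRing R] [Fintype R] {m n : Type*}
    [Fintype m] [Fintype n] [DecidableEq m] [DecidableEq n] :
    (∑ A : Matrix m n R, (Nat.card {x : m → R // x ᵥ* A = 0} : ℚ)) / Nat.card (Matrix m n R) =
      ∑ x : m → R, ((Nat.card (Ideal.span (Set.range x)) : ℚ) ^ Fintype.card n)⁻¹ := by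
  rw [← Nat.cast_sum, sum_card_vecMul_eq_zero, Nat.cast_sum, sum_div]
  refine sum_congr rfl fun x _ => ?_
  have h1 : Nat.card (Matrix m n R) = (Nat.card R ^ Fintype.card m) ^ Fintype.card n := by
    rw [show Nat.card (Matrix m n R) = Nat.card (m → n → R) from rfl, Nat.card_fun, Nat.card_fun,
      Nat.card_eq_fintype_card (α := m), Nat.card_eq_fintype_card (α := n), ← pow_mul, ← pow_mul,
      mul_comm]
  rw [h1, ← card_dotProduct_eq_zero_mul x, mul_pow, Nat.cast_mul, Nat.cast_pow, Nat.cast_pow,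
    div_mul_cancel_left₀]
  have : Nonempty {y : m → R // x ⬝ᵥ y = 0} := ⟨⟨0, by simp⟩⟩
  exact pow_ne_zero _ (Nat.cast_ne_zero.2 Nat.card_pos.ne')

/-- Vectors whose entries generate an ideal inside `J l` are those with all entries in `J l`.
Passing from `l` to `l + 1` adds precisely the vectors that generate `J (l + 1)`, as no ideal lies
strictly between. -/
theorem sum_card_span_le {R : Type*} [CommRing R] [Fintype R] {q k : ℕ} (hq : 1 < q)
    (J : ℕ → Ideal R) (hJ : Monotone J) (hcard : ∀ m ≤ k, Nat.card (J m) = q ^ m)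
    (hall : ∀ I : Ideal R, ∃ m ≤ k, I = J m) (m : Type*) [Fintype m] [DecidableEq m] (e l : ℕ)
    (hl : l ≤ k) :
    (open Classical in ∑ x : m → R with Ideal.span (Set.range x) ≤ J l,
      ((Nat.card (Ideal.span (Set.range x)) : ℚ) ^ e)⁻¹) =
      1 + ∑ j ∈ Icc 1 l, ((q : ℚ) ^ (j * Fintype.card m) - (q : ℚ) ^ ((j - 1) * Fintype.card m)) *
        ((q : ℚ) ^ (j * e))⁻¹ := by
  classical
  have hcardle : ∀ l ≤ k, #{x : m → R | Ideal.span (Set.range x) ≤ J l} =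
      q ^ (l * Fintype.card m) := fun l hl => by
    rw [pow_mul, ← hcard l hl, ← Nat.card_eq_fintype_card (α := m), ← Nat.card_fun,
      ← Fintype.card_subtype, ← Nat.card_eq_fintype_card]
    refine Nat.card_congr ((Equiv.subtypeEquivRight fun x => ?_).trans
      (Equiv.subtypePiEquivPi (p := fun _ y => y ∈ J l)))
    rw [Ideal.span_le, Set.range_subset_iff]
    rfl
  induction l with
  | zero =>
    have h0 : J 0 = ⊥ := by
      have := hcard 0 hl
      rw [pow_zero, Nat.card_eq_one_iff_unique] at this
      have := this.1
      exact (Submodule.subsingleton_iff_eq_bot).1 this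
    rw [sum_congr (g := fun _ => (1 : ℚ)) rfl]
    · rw [sum_const, hcardle 0 hl]
      simp
    · intro x hx
      rw [mem_filter, h0, le_bot_iff] at hx
      rw [hx.2]
      simp
  | succ l ih =>
    have hstep : ∀ x : m → R, Ideal.span (Set.range x) ≤ J (l + 1) ∧
        ¬ Ideal.span (Set.range x) ≤ J l ↔ Ideal.span (Set.range x) = J (l + 1) := fun x => by
      constructor
      · rintro ⟨h1, h2⟩
        obtain ⟨j, hj, hI⟩ := hall (Ideal.span (Set.range x))
        rw [hI] at h1 h2 ⊢
        have hjl : l < j := not_le.1 fun h => h2 (hJ h)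
        have h3 : Nat.card (J j) ≤ Nat.card (J (l + 1)) :=
          Nat.card_le_card_of_injective _ (Submodule.inclusion_injective h1)
        rw [hcard j hj, hcard _ hl, Nat.pow_le_pow_iff_right hq] at h3
        rw [show j = l + 1 by omega]
      · intro h
        rw [h]
        refine ⟨le_rfl, fun h1 => ?_⟩
        have h3 : Nat.card (J (l + 1)) ≤ Nat.card (J l) :=
          Nat.card_le_card_of_injective _ (Submodule.inclusion_injective h1)
        rw [hcard l (by omega), hcard _ hl, Nat.pow_le_pow_iff_right hq] at h3
        omega
    have hfilter : ({x : m → R | Ideal.span (Set.range x) ≤ J (l + 1)} : Finset (m → R)).filter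
        (fun x => Ideal.span (Set.range x) ≤ J l) =
        ({x : m → R | Ideal.span (Set.range x) ≤ J l} : Finset (m → R)) := by
      ext x
      simp only [mem_filter, mem_univ, true_and, and_iff_right_iff_imp]
      exact fun h => h.trans (hJ l.le_succ)
    have hsplit := card_filter_add_card_filter_not
      (s := ({x : m → R | Ideal.span (Set.range x) ≤ J (l + 1)} : Finset (m → R)))
      (fun x => Ideal.span (Set.range x) ≤ J l)
    rw [hfilter, hcardle l (by omega), hcardle _ hl] at hsplit
    rw [← sum_filter_add_sum_filter_not _ (fun x => Ideal.span (Set.range x) ≤ J l), hfilter,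
      ih (by omega), sum_Icc_succ_top (by omega), ← add_assoc]
    congr 1
    rw [sum_congr (g := fun _ => ((q : ℚ) ^ ((l + 1) * e))⁻¹) rfl]
    · rw [sum_const, nsmul_eq_mul]
      congr 1
      rw [Nat.add_sub_cancel, eq_sub_iff_add_eq, add_comm]
      exact_mod_cast hsplit
    · intro x hx
      rw [mem_filter, mem_filter, and_assoc, hstep] at hx
      rw [hx.2, hcard _ hl, Nat.cast_pow, pow_mul]

theorem average_card_vecMul_eq_zero_of_chain {R : Type*} [CommRing R] [Fintype R] {q k : ℕ}
    (hq : 1 < q) (J : ℕ → Ideal R) (hJ : Monotone J) (hcard : ∀ m ≤ k, Nat.card (J m) = q ^ m)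
    (hall : ∀ I : Ideal R, ∃ m ≤ k, I = J m) (d e : ℕ) :
    (∑ A : Matrix (Fin d) (Fin e) R, (Nat.card {x : Fin d → R // x ᵥ* A = 0} : ℚ)) /
        Nat.card (Matrix (Fin d) (Fin e) R) =
      ∑ j ∈ Icc 0 k, ((q : ℚ) ^ ((d : ℤ) - e)) ^ j +
        -((q : ℚ) ^ d)⁻¹ * ∑ j ∈ Icc 1 k, ((q : ℚ) ^ ((d : ℤ) - e)) ^ j := by
  classical
  have hq0 : (q : ℚ) ≠ 0 := Nat.cast_ne_zero.2 (by omega)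
  have htop : ∀ I : Ideal R, I ≤ J k := fun I => by
    obtain ⟨m, hm, rfl⟩ := hall I
    exact hJ hm
  have h := sum_card_span_le hq J hJ hcard hall (Fin d) e k le_rfl
  rw [filter_true_of_mem fun x _ => htop _] at h
  rw [average_card_vecMul_eq_zero, Fintype.card_fin, h, Fintype.card_fin,
    -- The term `j = 0` is the contribution 1 of the zero vector.
    ← add_sum_Ioc_eq_sum_Icc (Nat.zero_le k), pow_zero, add_assoc,
    show Ioc 0 k = Icc 1 k from (Icc_add_one_left_eq_Ioc 0 k).symm, mul_sum, ← sum_add_distrib]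
  congr 1
  refine sum_congr rfl fun j hj => ?_
  obtain ⟨i, rfl⟩ : ∃ i, j = i + 1 := ⟨j - 1, by have := (mem_Icc.1 hj).1; omega⟩
  rw [Nat.add_sub_cancel, zpow_sub₀ hq0, zpow_natCast, zpow_natCast, div_pow, ← pow_mul, ← pow_mul,
    mul_comm (i + 1) d, mul_comm (i + 1) e, mul_comm i d, mul_add_one d, pow_add]
  field_simp
  ring

end Average

/-! ### Diagonal direct sums -/

section DirectSum

open Finset Matrix

theorem vecMul_blockDiagonal' {R : Type*} [CommRing R] {ι : Type*} [Fintype ι] [DecidableEq ι]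
    {m n : ι → Type*} [∀ i, Fintype (m i)] (A : ∀ i, Matrix (m i) (n i) R)
    (x : (Σ i, m i) → R) (i : ι) (j : n i) :
    (x ᵥ* blockDiagonal' A) ⟨i, j⟩ = ((fun l => x ⟨i, l⟩) ᵥ* A i) j := by
  simp only [vecMul, dotProduct, Fintype.sum_sigma]
  rw [sum_eq_single i]
  · simp
  · intro i' _ hne
    simp [blockDiagonal'_apply_ne _ _ _ hne]
  · simp

theorem card_vecMul_blockDiagonal' {R : Type*} [CommRing R] {ι : Type*} [Fintype ι]
    [DecidableEq ι] {m n : ι → Type*} [∀ i, Fintype (m i)] (A : ∀ i, Matrix (m i) (n i) R) :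
    Nat.card {x : (Σ i, m i) → R // x ᵥ* blockDiagonal' A = 0} =
      ∏ i, Nat.card {x : m i → R // x ᵥ* A i = 0} := by
  rw [← Nat.card_pi]
  exact Nat.card_congr
    { toFun := fun x i => ⟨fun l => x.1 ⟨i, l⟩, funext fun j => by
        rw [← vecMul_blockDiagonal', x.2]; rfl⟩
      invFun := fun y => ⟨fun p => (y p.1).1 p.2, funext fun p => by
        rw [vecMul_blockDiagonal']; exact congrFun (y p.1).2 p.2⟩
      left_inv := fun _ => rfl
      right_inv := fun _ => rfl }

theorem reduction_diagonalDirectSum_top {O : Type*} [CommRing O] [IsLocalRing O] {ι : Type*}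
    [DecidableEq ι] (m n : ι → Type*) (k : ℕ) :
    reduction (diagonalDirectSum fun i => (⊤ : Submodule O (Matrix (m i) (n i) O))) k =
      Set.range (blockDiagonal' :
        (∀ i, Matrix (m i) (n i) (O ⧸ IsLocalRing.maximalIdeal O ^ k)) → Matrix _ _ _) := by
  ext B
  constructor
  · rintro ⟨_, ⟨A, _, rfl⟩, rfl⟩
    exact ⟨fun i => (A i).map _, (blockDiagonal'_map A _ (map_zero _)).symm⟩
  · rintro ⟨A, rfl⟩
    -- Any set-theoretic section will do: `blockDiagonal'` supplies the zeros off the blocks, so `f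
    -- 0 = 0` is not needed.
    choose f hf using
      Ideal.Quotient.mk_surjective (I := IsLocalRing.maximalIdeal O ^ k)
    refine ⟨_, ⟨fun i => (A i).map f, fun _ => trivial, rfl⟩, ?_⟩
    dsimp only
    rw [blockDiagonal'_map _ _ (map_zero _)]
    congr 1
    funext i
    ext a b
    exact hf _

theorem averageKernelSize_diagonalDirectSum_top {O : Type*} [CommRing O] [IsLocalRing O]
    {ι : Type*} [Fintype ι] [DecidableEq ι] (m n : ι → Type*) [∀ i, Fintype (m i)]
    [∀ i, Fintype (n i)] [∀ i, DecidableEq (m i)] [∀ i, DecidableEq (n i)] (k : ℕ)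
    [Fintype (O ⧸ IsLocalRing.maximalIdeal O ^ k)] :
    averageKernelSize (diagonalDirectSum fun i => (⊤ : Submodule O (Matrix (m i) (n i) O))) k =
      ∏ i, (∑ A : Matrix (m i) (n i) (O ⧸ IsLocalRing.maximalIdeal O ^ k),
        (Nat.card {x : m i → O ⧸ IsLocalRing.maximalIdeal O ^ k // x ᵥ* A = 0} : ℚ)) /
          Nat.card (Matrix (m i) (n i) (O ⧸ IsLocalRing.maximalIdeal O ^ k)) := by
  classical
  rw [averageKernelSize, reduction_diagonalDirectSum_top,
    finsum_mem_range blockDiagonal'_injective, finsum_eq_sum_of_fintype, prod_div_distrib]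
  congr 1
  · rw [prod_univ_sum, Fintype.piFinset_univ]
    refine sum_congr rfl fun A _ => ?_
    rw [card_vecMul_blockDiagonal', Nat.cast_prod]
  · rw [Nat.card_range_of_injective blockDiagonal'_injective, Nat.card_pi, Nat.cast_prod]

end DirectSum

/-! ### Finite quotients of discrete valuation rings -/

section Quotients

open IsLocalRing

variable {O : Type*} [CommRing O] [IsDomain O] [IsDiscreteValuationRing O]

theorem natCard_quotient_maximalIdeal_pow (k : ℕ) :
    Nat.card (O ⧸ maximalIdeal O ^ k) = Nat.card (ResidueField O) ^ k :=
  cardQuot_pow_of_prime (IsDiscreteValuationRing.not_a_field O)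

/-- The preimage of `I` contains the nonzero ideal `maximalIdeal O ^ k`, hence is itself a power of
the maximal ideal. -/
theorem ideal_quotient_eq_map_maximalIdeal_pow {k : ℕ} (I : Ideal (O ⧸ maximalIdeal O ^ k)) :
    ∃ j ≤ k, I = (maximalIdeal O ^ j).map (Ideal.Quotient.mk (maximalIdeal O ^ k)) := by
  have hle : maximalIdeal O ^ k ≤ I.comap (Ideal.Quotient.mk (maximalIdeal O ^ k)) := by
    intro x hx
    rw [Ideal.mem_comap, Ideal.Quotient.eq_zero_iff_mem.2 hx]
    exact I.zero_mem
  have hne : I.comap (Ideal.Quotient.mk (maximalIdeal O ^ k)) ≠ ⊥ := fun h => by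
    rw [h, le_bot_iff] at hle
    exact pow_ne_zero k (IsDiscreteValuationRing.not_a_field O) hle
  obtain ⟨j, hj⟩ := exists_maximalIdeal_pow_eq_of_principal O
    (IsPrincipalIdealRing.principal _) _ hne
  have hI : I = (maximalIdeal O ^ j).map (Ideal.Quotient.mk (maximalIdeal O ^ k)) := by
    rw [← hj, Ideal.map_comap_of_surjective _ Ideal.Quotient.mk_surjective]
  rcases le_total j k with h | h
  · exact ⟨j, h, hI⟩
  · refine ⟨k, le_rfl, ?_⟩
    have : maximalIdeal O ^ j = maximalIdeal O ^ k :=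
      le_antisymm (Ideal.pow_le_pow_right h) (hj ▸ hle)
    rw [hI, this]

theorem natCard_map_maximalIdeal_pow {k j : ℕ} (hj : j ≤ k)
    (hq : Nat.card (ResidueField O) ≠ 0) :
    Nat.card ((maximalIdeal O ^ j).map (Ideal.Quotient.mk (maximalIdeal O ^ k))) =
      Nat.card (ResidueField O) ^ (k - j) := by
  have h := ((maximalIdeal O ^ j).map (Ideal.Quotient.mk (maximalIdeal O ^ k))).toAddSubgroup
    |>.card_eq_card_quotient_mul_card_addSubgroup
  have h1 : Nat.card ((O ⧸ maximalIdeal O ^ k) ⧸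
      ((maximalIdeal O ^ j).map (Ideal.Quotient.mk (maximalIdeal O ^ k))).toAddSubgroup) =
      Nat.card (ResidueField O) ^ j := by
    rw [← natCard_quotient_maximalIdeal_pow]
    exact Nat.card_congr (DoubleQuot.quotQuotEquivQuotOfLE (Ideal.pow_le_pow_right hj)).toEquiv
  rw [h1, natCard_quotient_maximalIdeal_pow, ← Nat.add_sub_cancel' hj, pow_add] at h
  rw [Nat.add_sub_cancel' hj] at h
  exact (Nat.eq_of_mul_eq_mul_left (pow_pos (Nat.pos_of_ne_zero hq) j) h).symm

theorem averageKernelSize_diagonalDirectSum {n : ℕ} (d e : Fin n → ℕ) (k : ℕ)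
    [Finite (ResidueField O)] :
    averageKernelSize (diagonalDirectSum fun i =>
        (⊤ : Submodule O (Matrix (Fin (d i)) (Fin (e i)) O))) k =
      ∏ i, (∑ j ∈ Finset.Icc 0 k,
          ((Nat.card (ResidueField O) : ℚ) ^ ((d i : ℤ) - e i)) ^ j +
        -((Nat.card (ResidueField O) : ℚ) ^ d i)⁻¹ * ∑ j ∈ Finset.Icc 1 k,
          ((Nat.card (ResidueField O) : ℚ) ^ ((d i : ℤ) - e i)) ^ j) := by
  have hq : 1 < Nat.card (ResidueField O) := Finite.one_lt_card
  have : Finite (O ⧸ maximalIdeal O ^ k) := Nat.finite_of_card_ne_zero <| by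
    rw [natCard_quotient_maximalIdeal_pow]
    exact pow_ne_zero k (by omega)
  have := Fintype.ofFinite (O ⧸ maximalIdeal O ^ k)
  rw [averageKernelSize_diagonalDirectSum_top]
  refine Finset.prod_congr rfl fun i _ => ?_
  refine average_card_vecMul_eq_zero_of_chain hq
    -- The chain is indexed in reverse so that its `m`th member has q^m elements.
    (fun m => (maximalIdeal O ^ (k - m)).map (Ideal.Quotient.mk (maximalIdeal O ^ k)))
    (fun a b hab => Ideal.map_mono (Ideal.pow_le_pow_right (by omega))) (fun m hm => ?_)
    (fun I => ?_) (d i) (e i)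
  · rw [natCard_map_maximalIdeal_pow (Nat.sub_le k m) (by omega), Nat.sub_sub_self hm]
  · obtain ⟨j, hj, hI⟩ := ideal_quotient_eq_map_maximalIdeal_pow I
    exact ⟨k - j, Nat.sub_le k j, by rw [Nat.sub_sub_self hj, hI]⟩

end Quotients

end AskHadamard

theorem mainTheorem3
    {O : Type*} [CommRing O] [IsDomain O] [IsDiscreteValuationRing O]
    [TopologicalSpace O] [IsTopologicalRing O] [CompactSpace O]
    (hadic : IsAdic (IsLocalRing.maximalIdeal O))
    (q : ℕ) (hq : q = Nat.card (IsLocalRing.ResidueField O))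
    (n : ℕ) (d e : Fin n → ℕ) (δ : ℤ) (hδ : ∀ i, (d i : ℤ) - (e i : ℤ) = δ)
    (α : AskHadamard.Colour → AskHadamard.labelGroup)
    (hα : ∀ i : Fin n,
      ((α (AskHadamard.colour (i.val + 1)) : (RatFunc ℚ)ˣ) : RatFunc ℚ) =
        -(RatFunc.X : RatFunc ℚ) ^ (-(d i : ℤ)))
    (hα_one : ∀ c : AskHadamard.Colour,
      (∀ i : Fin n, c ≠ AskHadamard.colour (i.val + 1)) → α c = 1) :
    AskHadamard.askZeta
        (AskHadamard.diagonalDirectSum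
          (fun i : Fin n => (⊤ : Submodule O (Matrix (Fin (d i)) (Fin (e i)) O)))) =
      (∑ a ∈ AskHadamard.PiS n,
        PowerSeries.C (AskHadamard.labelAt α (q : ℚ) a * (q : ℚ) ^ (δ * (a.comaj : ℤ))) *
          (PowerSeries.X : PowerSeries ℚ) ^ a.des) *
      (∏ i ∈ Finset.range (n + 1),
        (1 - PowerSeries.C ((q : ℚ) ^ ((i : ℤ) * δ)) * (PowerSeries.X : PowerSeries ℚ)))⁻¹ := by
  -- The maximal ideal is open in the adic topology, so compactness makes its index finite.
  have hfin : Finite (IsLocalRing.ResidueField O) := by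
    refine AddSubgroup.quotient_finite_of_isOpen
      (IsLocalRing.maximalIdeal O).toAddSubgroup ?_
    have h := (isAdic_iff.1 hadic).1 1
    rwa [pow_one] at h
  have hq0 : (q : ℚ) ≠ 0 := by
    rw [hq]
    exact Nat.cast_ne_zero.2 Nat.card_pos.ne'
  rw [PowerSeries.eq_mul_inv_iff_mul_eq (by simp [map_prod])]
  -- Colour 0 is none of the colours `i + 1`, so its label is 1.
  have hv : AskHadamard.labelEval q hq0 (α (AskHadamard.colour 0)) = 1 := by
    rw [hα_one _ fun i h => by simpa using AskHadamard.colour_injective h, map_one]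
  have key := AskHadamard.mk_prod_mul_eq_sum_PiS (n := n) ((q : ℚ) ^ δ)
    (fun c => AskHadamard.labelEval q hq0 (α c)) hv
  have h1 : AskHadamard.askZeta
        (AskHadamard.diagonalDirectSum
          (fun i : Fin n => (⊤ : Submodule O (Matrix (Fin (d i)) (Fin (e i)) O)))) =
      PowerSeries.mk fun k => ∏ i : Fin n, (∑ j ∈ Finset.Icc 0 k, ((q : ℚ) ^ δ) ^ j +
        AskHadamard.labelEval q hq0 (α (AskHadamard.colour (i + 1))) *
          ∑ j ∈ Finset.Icc 1 k, ((q : ℚ) ^ δ) ^ j) := by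
    rw [AskHadamard.askZeta]
    congr 1
    funext k
    rw [AskHadamard.averageKernelSize_diagonalDirectSum, ← hq]
    refine Finset.prod_congr rfl fun i _ => ?_
    rw [hδ, AskHadamard.labelEval_eq hq0 (hα i)]
  have h2 : ∀ i : ℕ, (q : ℚ) ^ ((i : ℤ) * δ) = ((q : ℚ) ^ δ) ^ i := fun i => by
    rw [mul_comm, zpow_mul, zpow_natCast]
  have h3 : ∀ i : ℕ, (q : ℚ) ^ (δ * (i : ℤ)) = ((q : ℚ) ^ δ) ^ i := fun i => by
    rw [zpow_mul, zpow_natCast]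
  simp_rw [h1, h2, h3, AskHadamard.labelAt_eq_prod α hq0]
  exact key
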